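/- Let $n\ge 2$. There is a compactly supported function $u:\mathbb{R}^n\to\mathbb{R}$ that is twice differentiable at every point of $\mathbb{R}^n$ (that is, $u$ is differentiable and its derivative $Du$ is differentiable at every point), has continuous Laplacian $\Delta u$ and bounded Hessian $D^2u$, but is not in $C^2(\mathbb{R}^n)$, and whose graph $$\Sigma=\{(x,u(x)) : x\in\mathbb{R}^n\}\subset\mathbb{R}^{n+1}$$ has the following properties: 1. $\Sigma$ is a twice differentiable hypersurface: near each of its points it is the zero set of a twice differentiable function with nowhere vanishing differential. 2. $\Sigma$ is not a $C^2$ hypersurface: it is not the case that near each of its points it is the zero set of a $C^2$ function with nowhere vanishing differential. 3. There is a continuous unit normal field $\nu$ along $\Sigma$ that is differentiable along $\Sigma$ at every point, such that, with the shape operator $S_p=-d\nu_p:T_p\Sigma\to T_p\Sigma$, the mean curvature $H(p)=\operatorname{tr}S_p$ (the sum of the principal curvatures) is a continuous function on $\Sigma$, and the second fundamental form $A_p(v,w)=\langle S_pv,w\rangle$ is bounded: there is a constant $C$ with $|A_p(v,w)|\le C|v||w|$ for all $p\in\Sigma$ and $v,w\in T_p\Sigma$. -/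

import Mathlib

open scoped RealInnerProductSpace Topology Laplacian

noncomputable section

/-- The real function `f` is twice differentiable (in the sense of Fréchet) at every point of the
open set `U`; its second derivative need not be continuous. -/
def TwiceDifferentiableOn {E : Type*} [NormedAddCommGroup E] [NormedSpace ℝ E]
    (f : E → ℝ) (U : Set E) : Prop :=
  DifferentiableOn ℝ f U ∧ DifferentiableOn ℝ (fderiv ℝ f) U

/-- `M` is a twice differentiable (embedded) hypersurface of `ℝ^d`: near each of its points it is
the zero set of a twice differentiable function whose differential does not vanish. -/
def IsTwiceDifferentiableHypersurface {d : ℕ} (M : Set (EuclideanSpace ℝ (Fin d))) : Prop :=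
  ∀ p ∈ M, ∃ (U : Set (EuclideanSpace ℝ (Fin d))) (F : EuclideanSpace ℝ (Fin d) → ℝ),
    IsOpen U ∧ p ∈ U ∧ TwiceDifferentiableOn F U ∧ (∀ q ∈ U, fderiv ℝ F q ≠ 0) ∧
      M ∩ U = {q ∈ U | F q = 0}

/-- `M` is an (embedded) hypersurface of class `C^2` of `ℝ^d`: near each of its points it is
the zero set of a `C^2` function whose differential does not vanish. -/
def IsC2Hypersurface {d : ℕ} (M : Set (EuclideanSpace ℝ (Fin d))) : Prop :=
  ∀ p ∈ M, ∃ (U : Set (EuclideanSpace ℝ (Fin d))) (F : EuclideanSpace ℝ (Fin d) → ℝ),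
    IsOpen U ∧ p ∈ U ∧ ContDiffOn ℝ 2 F U ∧ (∀ q ∈ U, fderiv ℝ F q ≠ 0) ∧
      M ∩ U = {q ∈ U | F q = 0}

/-- `v` is the velocity at time `0` of a curve in `M` that passes through `p` at time `0` and is
differentiable there. -/
def IsTangentVector {d : ℕ} (M : Set (EuclideanSpace ℝ (Fin d)))
    (p v : EuclideanSpace ℝ (Fin d)) : Prop :=
  ∃ γ : ℝ → EuclideanSpace ℝ (Fin d),
    γ 0 = p ∧ (∀ᶠ t in 𝓝 (0 : ℝ), γ t ∈ M) ∧ HasDerivAt γ v 0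

/-- The tangent space of `M` at `p`. (On a hypersurface the tangent vectors already form a linear
hyperplane, so that the span adds nothing.) -/
def tangentSpaceOf {d : ℕ} (M : Set (EuclideanSpace ℝ (Fin d)))
    (p : EuclideanSpace ℝ (Fin d)) : Submodule ℝ (EuclideanSpace ℝ (Fin d)) :=
  Submodule.span ℝ {v | IsTangentVector M p v}

/-- `ν` is a continuous unit normal vector field along `M`. -/
def IsUnitNormalField {d : ℕ} (M : Set (EuclideanSpace ℝ (Fin d)))
    (ν : EuclideanSpace ℝ (Fin d) → EuclideanSpace ℝ (Fin d)) : Prop :=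
  ContinuousOn ν M ∧ ∀ p ∈ M, ‖ν p‖ = 1 ∧ ∀ v ∈ tangentSpaceOf M p, ⟪ν p, v⟫ = 0

/-- The shape operator (Weingarten map) `v ↦ - dν(v)` of `M` at `p`, for a unit normal field `ν`
that is differentiable along `M`. The derivative of `ν` within `M` is determined on the tangent
space; there it takes tangential values because `ν` has unit length, so that the orthogonal
projection only serves to land in the tangent space. -/
def shapeOperator {d : ℕ} (M : Set (EuclideanSpace ℝ (Fin d)))
    (ν : EuclideanSpace ℝ (Fin d) → EuclideanSpace ℝ (Fin d)) (p : EuclideanSpace ℝ (Fin d)) :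
    tangentSpaceOf M p →L[ℝ] tangentSpaceOf M p :=
  -((tangentSpaceOf M p).orthogonalProjectionOnto ∘L fderivWithin ℝ ν M p ∘L
      (tangentSpaceOf M p).subtypeL)

/-- The (scalar) second fundamental form of `M` at `p` with respect to `ν`. -/
def secondFundamentalForm {d : ℕ} (M : Set (EuclideanSpace ℝ (Fin d)))
    (ν : EuclideanSpace ℝ (Fin d) → EuclideanSpace ℝ (Fin d)) (p : EuclideanSpace ℝ (Fin d))
    (v w : tangentSpaceOf M p) : ℝ :=
  ⟪shapeOperator M ν p v, w⟫

/-- The mean curvature of `M` at `p` with respect to `ν`: the trace of the shape operator, that is,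
the sum of the principal curvatures. -/
def meanCurvature {d : ℕ} (M : Set (EuclideanSpace ℝ (Fin d)))
    (ν : EuclideanSpace ℝ (Fin d) → EuclideanSpace ℝ (Fin d)) (p : EuclideanSpace ℝ (Fin d)) : ℝ :=
  LinearMap.trace ℝ (tangentSpaceOf M p) (shapeOperator M ν p).toLinearMap

/-- The graph `{(x, u x)}` in `ℝ^(n+1)` of a function `u` on `ℝ^n`. -/
def graphOf {n : ℕ} (u : EuclideanSpace ℝ (Fin n) → ℝ) : Set (EuclideanSpace ℝ (Fin (n + 1))) :=
  {p | p (Fin.last n) = u (WithLp.toLp 2 fun i : Fin n => p i.castSucc)}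

end

/-! The saddle `x i * x j` with `i ≠ j` is harmonic, yet its Hessian does not vanish. Multiply it by
`h (‖x‖ ^ 2)`, where `h` is a cut-off that varies slowly on the logarithmic scale. The Laplacian of
the product contains only `s h'(s)` and `s² h''(s)`, which are of order `ε`, while the Hessian is
bounded independently of `ε` and of the support radius and keeps the entry 1 at the centre
(`exists_log_cutoff`, `exists_saddle_bump`).

Put such bumps, with `ε = 2⁻ᵏ`, into disjoint balls of radius `4⁻ᵏ/4` around `2⁻ᵏ eᵢ`. Their sum `u`
is `C²` off the origin, with `u` and `Du` of order `|x|²`, `D²u` bounded and `Δu` of order `|x|`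
(`exists_oscillating_bump_sum`). Hence `Du` is differentiable at 0 with derivative 0 and `Δu` is
continuous, but `D²u` has norm at least 1 at centres that tend to 0.

For the graph, with `W = √(1 + |Du|²)`, the mean curvature is `W⁻¹ Δu - W⁻³ D²u(Du, Du)`
(`meanCurvature_graphOf`). The second term is continuous at 0 because `D²u` is bounded and `Du`
tends to 0. The second fundamental form is `W⁻¹ D²u`, hence bounded. A `C²` defining function would
make `u` itself `C²`, by implicit differentiation (`IsC2Hypersurface.continuous_fderiv_fderiv`). -/

/-! ### Coordinates on `ℝ^(n+1)` and points of a graph -/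

/-- The projection of `ℝ^(n+1)` to `ℝ^n` that forgets the last coordinate. -/
noncomputable def dropLast (n : ℕ) :
    EuclideanSpace ℝ (Fin (n + 1)) →L[ℝ] EuclideanSpace ℝ (Fin n) :=
  LinearMap.toContinuousLinearMap
    { toFun := fun p => WithLp.toLp 2 fun i : Fin n => p i.castSucc
      map_add' := fun _ _ => rfl
      map_smul' := fun _ _ => rfl }

/-- The inclusion of `ℝ^n` into `ℝ^(n+1)` as the hyperplane where the last coordinate vanishes. -/
noncomputable def padZero (n : ℕ) : EuclideanSpace ℝ (Fin n) →L[ℝ] EuclideanSpace ℝ (Fin (n + 1)) :=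
  LinearMap.toContinuousLinearMap
    { toFun := fun x => WithLp.toLp 2 (Fin.snoc (α := fun _ => ℝ) (fun i => x i) 0)
      map_add' := fun x y => by
        ext i; refine Fin.lastCases ?_ (fun j => ?_) i <;> simp
      map_smul' := fun c x => by
        ext i; refine Fin.lastCases ?_ (fun j => ?_) i <;> simp }

/-- The last coordinate of `ℝ^(n+1)`. -/
noncomputable abbrev lastCoord (n : ℕ) : EuclideanSpace ℝ (Fin (n + 1)) →L[ℝ] ℝ :=
  EuclideanSpace.proj (Fin.last n)

/-- The last vector of the standard basis of `ℝ^(n+1)`. -/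
noncomputable abbrev lastVec (n : ℕ) : EuclideanSpace ℝ (Fin (n + 1)) :=
  EuclideanSpace.single (Fin.last n) 1

section Graph

variable {n : ℕ}

theorem dropLast_apply (p : EuclideanSpace ℝ (Fin (n + 1))) (i : Fin n) :
    dropLast n p i = p i.castSucc := rfl

@[simp] theorem padZero_castSucc (x : EuclideanSpace ℝ (Fin n)) (i : Fin n) :
    padZero n x i.castSucc = x i := by
  simp [padZero]

@[simp] theorem padZero_last (x : EuclideanSpace ℝ (Fin n)) : padZero n x (Fin.last n) = 0 := by
  simp [padZero]

@[simp] theorem dropLast_padZero (x : EuclideanSpace ℝ (Fin n)) : dropLast n (padZero n x) = x := by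
  ext i; simp [dropLast_apply]

@[simp] theorem dropLast_lastVec : dropLast n (lastVec n) = 0 := by
  ext i; simp [dropLast_apply, Fin.castSucc_ne_last]

theorem mem_graphOf {u : EuclideanSpace ℝ (Fin n) → ℝ} {p : EuclideanSpace ℝ (Fin (n + 1))} :
    p ∈ graphOf u ↔ p (Fin.last n) = u (dropLast n p) := Iff.rfl

theorem inner_eq_dropLast_add (p q : EuclideanSpace ℝ (Fin (n + 1))) :
    ⟪p, q⟫ = ⟪dropLast n p, dropLast n q⟫ + p (Fin.last n) * q (Fin.last n) := by
  simp [PiLp.inner_apply, Fin.sum_univ_castSucc, dropLast_apply, mul_comm]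

theorem norm_dropLast_le (p : EuclideanSpace ℝ (Fin (n + 1))) : ‖dropLast n p‖ ≤ ‖p‖ := by
  have h := inner_eq_dropLast_add p p
  rw [real_inner_self_eq_norm_sq, real_inner_self_eq_norm_sq] at h
  exact le_of_sq_le_sq (by nlinarith [mul_self_nonneg (p (Fin.last n))]) (norm_nonneg _)

theorem padZero_dropLast_add (p : EuclideanSpace ℝ (Fin (n + 1))) :
    padZero n (dropLast n p) + p (Fin.last n) • lastVec n = p := by
  ext i
  refine Fin.lastCases ?_ (fun j => ?_) i
  · simp
  · simp [dropLast_apply, Fin.castSucc_ne_last]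

/-- The point of the graph of `u` above `x`. -/
noncomputable def graphPoint (u : EuclideanSpace ℝ (Fin n) → ℝ) (x : EuclideanSpace ℝ (Fin n)) :
    EuclideanSpace ℝ (Fin (n + 1)) :=
  padZero n x + u x • lastVec n

@[simp] theorem dropLast_graphPoint (u : EuclideanSpace ℝ (Fin n) → ℝ)
    (x : EuclideanSpace ℝ (Fin n)) : dropLast n (graphPoint u x) = x := by
  simp [graphPoint]

theorem graphPoint_last (u : EuclideanSpace ℝ (Fin n) → ℝ)
    (x : EuclideanSpace ℝ (Fin n)) : graphPoint u x (Fin.last n) = u x := by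
  simp [graphPoint]

theorem graphPoint_mem (u : EuclideanSpace ℝ (Fin n) → ℝ) (x : EuclideanSpace ℝ (Fin n)) :
    graphPoint u x ∈ graphOf u := by
  rw [mem_graphOf, dropLast_graphPoint, graphPoint_last]

theorem graphPoint_dropLast {u : EuclideanSpace ℝ (Fin n) → ℝ}
    {p : EuclideanSpace ℝ (Fin (n + 1))} (hp : p ∈ graphOf u) :
    graphPoint u (dropLast n p) = p := by
  rw [graphPoint, ← mem_graphOf.1 hp, padZero_dropLast_add]

/-! ### Tangent spaces of a graph -/

theorem hasFDerivAt_graphPoint {u : EuclideanSpace ℝ (Fin n) → ℝ} {x : EuclideanSpace ℝ (Fin n)}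
    (hu : DifferentiableAt ℝ u x) :
    HasFDerivAt (graphPoint u) (padZero n + (fderiv ℝ u x).smulRight (lastVec n)) x :=
  (padZero n).hasFDerivAt.add (hu.hasFDerivAt.smul_const (lastVec n))

theorem isTangentVector_graphOf_iff {u : EuclideanSpace ℝ (Fin n) → ℝ}
    {p : EuclideanSpace ℝ (Fin (n + 1))} (hp : p ∈ graphOf u)
    (hu : DifferentiableAt ℝ u (dropLast n p)) (v : EuclideanSpace ℝ (Fin (n + 1))) :
    IsTangentVector (graphOf u) p v ↔
      v (Fin.last n) = fderiv ℝ u (dropLast n p) (dropLast n v) := by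
  constructor
  · rintro ⟨γ, h0, hmem, hγ⟩
    have h1 : HasDerivAt (fun t => γ t (Fin.last n)) (v (Fin.last n)) 0 :=
      (lastCoord n).hasFDerivAt.comp_hasDerivAt 0 hγ
    have h2 : HasDerivAt (fun t => dropLast n (γ t)) (dropLast n v) 0 :=
      (dropLast n).hasFDerivAt.comp_hasDerivAt 0 hγ
    have h3 : HasDerivAt (fun t => u (dropLast n (γ t)))
        (fderiv ℝ u (dropLast n p) (dropLast n v)) 0 := by
      have h4 : HasFDerivAt u (fderiv ℝ u (dropLast n p)) (dropLast n (γ 0)) := by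
        rw [h0]; exact hu.hasFDerivAt
      exact h4.comp_hasDerivAt (f := fun t => dropLast n (γ t)) 0 h2
    exact h1.unique (h3.congr_of_eventuallyEq (hmem.mono fun t ht => ht))
  · intro hv
    refine ⟨fun t => graphPoint u (dropLast n p + t • dropLast n v), ?_, ?_, ?_⟩
    · simpa using graphPoint_dropLast hp
    · exact Filter.Eventually.of_forall fun t => graphPoint_mem u _
    · have h1 : HasDerivAt (fun t : ℝ => dropLast n p + t • dropLast n v) (dropLast n v) 0 := by
        simpa using ((hasDerivAt_id (0 : ℝ)).smul_const (dropLast n v)).const_add (dropLast n p)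
      have h2 := (hasFDerivAt_graphPoint (u := u)
        (x := dropLast n p + (0 : ℝ) • dropLast n v) (by simpa using hu)).comp_hasDerivAt
          (f := fun t : ℝ => dropLast n p + t • dropLast n v) 0 h1
      refine h2.congr_deriv ?_
      have h3 := padZero_dropLast_add v
      rw [hv] at h3
      simpa using h3

theorem mem_tangentSpaceOf_graphOf {u : EuclideanSpace ℝ (Fin n) → ℝ}
    {p : EuclideanSpace ℝ (Fin (n + 1))} (hp : p ∈ graphOf u)
    (hu : DifferentiableAt ℝ u (dropLast n p)) (v : EuclideanSpace ℝ (Fin (n + 1))) :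
    v ∈ tangentSpaceOf (graphOf u) p ↔
      v (Fin.last n) = fderiv ℝ u (dropLast n p) (dropLast n v) := by
  have h : {v | IsTangentVector (graphOf u) p v} =
      ((lastCoord n - (fderiv ℝ u (dropLast n p)).comp (dropLast n)).ker : Set _) := by
    ext v
    simp [isTangentVector_graphOf_iff hp hu, sub_eq_zero]
  rw [tangentSpaceOf, h, Submodule.span_eq]
  simp [sub_eq_zero]

/-- A derivative within `M` need not be unique on the whole space. Along a curve in `M`, however,
any such derivative sends the velocity of the curve to that of its image under `ν`, and tangent
vectors are spanned by these velocities. -/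
theorem fderivWithin_eq_of_isTangentVector {d : ℕ} {M : Set (EuclideanSpace ℝ (Fin d))}
    {ν : EuclideanSpace ℝ (Fin d) → EuclideanSpace ℝ (Fin d)}
    {N : EuclideanSpace ℝ (Fin d) →L[ℝ] EuclideanSpace ℝ (Fin d)} {p v : EuclideanSpace ℝ (Fin d)}
    (hν : HasFDerivAt ν N p) (hv : v ∈ tangentSpaceOf M p) :
    fderivWithin ℝ ν M p v = N v := by
  have h : tangentSpaceOf M p ≤ (fderivWithin ℝ ν M p - N).ker := by
    refine Submodule.span_le.2 ?_
    rintro w ⟨γ, h0, hmem, hγ⟩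
    have h1 := hν.hasFDerivWithinAt.differentiableWithinAt (s := M).hasFDerivWithinAt
    have h2 := h1.comp_hasDerivAt_of_eq 0 hγ hmem h0.symm
    have h3 := hν.comp_hasDerivAt_of_eq 0 hγ h0.symm
    simpa [sub_eq_zero] using h2.unique h3
  simpa [sub_eq_zero] using h hv

/-! ### The unit normal of a graph and its derivative -/

/-- The vector that represents a linear form on `ℝ^n`. -/
noncomputable def rieszVec (n : ℕ) :
    (EuclideanSpace ℝ (Fin n) →L[ℝ] ℝ) →L[ℝ] EuclideanSpace ℝ (Fin n) :=
  LinearMap.toContinuousLinearMap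
    { toFun := fun φ => WithLp.toLp 2 fun i => φ (EuclideanSpace.single i 1)
      map_add' := fun _ _ => rfl
      map_smul' := fun _ _ => rfl }

theorem rieszVec_apply (φ : EuclideanSpace ℝ (Fin n) →L[ℝ] ℝ) (i : Fin n) :
    rieszVec n φ i = φ (EuclideanSpace.single i 1) := rfl

theorem inner_rieszVec (φ : EuclideanSpace ℝ (Fin n) →L[ℝ] ℝ) (x : EuclideanSpace ℝ (Fin n)) :
    ⟪rieszVec n φ, x⟫ = φ x := by
  conv_rhs => rw [← (EuclideanSpace.basisFun (Fin n) ℝ).sum_repr x]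
  simp [PiLp.inner_apply, rieszVec_apply]

/-- The upward normal `(-Du, 1)` of the graph, in terms of the differential of the function. -/
noncomputable def upNormal (n : ℕ) (φ : EuclideanSpace ℝ (Fin n) →L[ℝ] ℝ) :
    EuclideanSpace ℝ (Fin (n + 1)) :=
  lastVec n - padZero n (rieszVec n φ)

@[simp] theorem dropLast_upNormal (φ : EuclideanSpace ℝ (Fin n) →L[ℝ] ℝ) :
    dropLast n (upNormal n φ) = - rieszVec n φ := by
  simp [upNormal]

@[simp] theorem upNormal_last (φ : EuclideanSpace ℝ (Fin n) →L[ℝ] ℝ) :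
    upNormal n φ (Fin.last n) = 1 := by
  simp [upNormal]

theorem inner_upNormal (φ : EuclideanSpace ℝ (Fin n) →L[ℝ] ℝ)
    (v : EuclideanSpace ℝ (Fin (n + 1))) :
    ⟪upNormal n φ, v⟫ = v (Fin.last n) - φ (dropLast n v) := by
  rw [inner_eq_dropLast_add, dropLast_upNormal, upNormal_last, inner_neg_left, inner_rieszVec]
  ring

/-- The length of the upward normal `(-Du, 1)`. -/
noncomputable def areaFactor (n : ℕ) (φ : EuclideanSpace ℝ (Fin n) →L[ℝ] ℝ) : ℝ :=
  √(1 + φ (rieszVec n φ))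

theorem apply_rieszVec_nonneg (φ : EuclideanSpace ℝ (Fin n) →L[ℝ] ℝ) : 0 ≤ φ (rieszVec n φ) := by
  rw [← inner_rieszVec]; exact real_inner_self_nonneg

theorem one_le_areaFactor (φ : EuclideanSpace ℝ (Fin n) →L[ℝ] ℝ) : 1 ≤ areaFactor n φ := by
  rw [areaFactor, Real.one_le_sqrt]
  linarith [apply_rieszVec_nonneg φ]

theorem areaFactor_pos (φ : EuclideanSpace ℝ (Fin n) →L[ℝ] ℝ) : 0 < areaFactor n φ :=
  one_pos.trans_le (one_le_areaFactor φ)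

theorem norm_upNormal (φ : EuclideanSpace ℝ (Fin n) →L[ℝ] ℝ) :
    ‖upNormal n φ‖ = areaFactor n φ := by
  rw [norm_eq_sqrt_real_inner, inner_upNormal]
  simp [areaFactor]

theorem hasFDerivAt_areaFactor_inv (φ : EuclideanSpace ℝ (Fin n) →L[ℝ] ℝ) :
    HasFDerivAt (fun φ => (areaFactor n φ)⁻¹)
      (-((areaFactor n φ ^ 3)⁻¹ • ContinuousLinearMap.apply ℝ ℝ (rieszVec n φ))) φ := by
  have h0 : HasFDerivAt (fun φ : EuclideanSpace ℝ (Fin n) →L[ℝ] ℝ => 1 + φ (rieszVec n φ))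
      ((2 : ℝ) • ContinuousLinearMap.apply ℝ ℝ (rieszVec n φ)) φ := by
    have := ((hasFDerivAt_id φ).clm_apply ((rieszVec n).hasFDerivAt (x := φ))).const_add 1
    refine this.congr_fderiv ?_
    ext ψ
    -- Symmetry of the inner product merges the two terms of the product rule into the factor 2.
    have : φ (rieszVec n ψ) = ψ (rieszVec n φ) := by
      rw [← inner_rieszVec, ← inner_rieszVec, real_inner_comm]
    simp [this, two_mul]
  have h1 := h0.sqrt (by linarith [apply_rieszVec_nonneg φ] : (1 + φ (rieszVec n φ)) ≠ 0)
  have h2 := (hasDerivAt_inv (areaFactor_pos φ).ne').comp_hasFDerivAt φ h1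
  refine h2.congr_fderiv ?_
  have := (areaFactor_pos φ).ne'
  change -(areaFactor n φ ^ 2)⁻¹ • (1 / (2 * areaFactor n φ)) • _ = _
  ext ψ
  simp
  field_simp

/-- The upward unit normal of the graph of `u`, extended so that it does not depend on the last
coordinate. -/
noncomputable def graphNormal (u : EuclideanSpace ℝ (Fin n) → ℝ)
    (p : EuclideanSpace ℝ (Fin (n + 1))) : EuclideanSpace ℝ (Fin (n + 1)) :=
  (areaFactor n (fderiv ℝ u (dropLast n p)))⁻¹ • upNormal n (fderiv ℝ u (dropLast n p))

/-- The derivative of the extended upward unit normal of the graph of `u`. -/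
noncomputable def graphNormalDeriv (u : EuclideanSpace ℝ (Fin n) → ℝ)
    (p : EuclideanSpace ℝ (Fin (n + 1))) :
    EuclideanSpace ℝ (Fin (n + 1)) →L[ℝ] EuclideanSpace ℝ (Fin (n + 1)) :=
  let x := dropLast n p
  let φ := fderiv ℝ u x
  let A := fderiv ℝ (fderiv ℝ u) x;
  -((areaFactor n φ)⁻¹ • (padZero n ∘L (rieszVec n ∘L A) ∘L dropLast n))
    - (((areaFactor n φ ^ 3)⁻¹ • (ContinuousLinearMap.apply ℝ ℝ (rieszVec n φ) ∘L A ∘L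
        dropLast n)).smulRight (upNormal n φ))

theorem norm_graphNormal (u : EuclideanSpace ℝ (Fin n) → ℝ)
    (p : EuclideanSpace ℝ (Fin (n + 1))) : ‖graphNormal u p‖ = 1 := by
  have := areaFactor_pos (fderiv ℝ u (dropLast n p))
  rw [graphNormal, norm_smul, norm_upNormal, norm_inv, Real.norm_of_nonneg this.le,
    inv_mul_cancel₀ this.ne']

theorem hasFDerivAt_graphNormal {u : EuclideanSpace ℝ (Fin n) → ℝ}
    {p : EuclideanSpace ℝ (Fin (n + 1))} (hu : DifferentiableAt ℝ (fderiv ℝ u) (dropLast n p)) :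
    HasFDerivAt (graphNormal u) (graphNormalDeriv u p) p := by
  have h1 : HasFDerivAt (fun p => fderiv ℝ u (dropLast n p))
      (fderiv ℝ (fderiv ℝ u) (dropLast n p) ∘L dropLast n) p :=
    hu.hasFDerivAt.comp p (dropLast n).hasFDerivAt
  have h2 := (hasFDerivAt_areaFactor_inv (fderiv ℝ u (dropLast n p))).comp p h1
  have h3 := (((padZero n ∘L rieszVec n).hasFDerivAt).comp p h1).const_sub (lastVec n)
  refine (h2.smul h3).congr_fderiv ?_
  ext1 v
  simp [graphNormalDeriv, upNormal, sub_eq_add_neg]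
  abel

/-- Differentiate `‖ν‖² = 1`. As a consequence the derivative takes tangential values on all of
`ℝ^(n+1)`, not only on tangent vectors. -/
theorem inner_graphNormal_graphNormalDeriv {u : EuclideanSpace ℝ (Fin n) → ℝ}
    {p : EuclideanSpace ℝ (Fin (n + 1))} (hu : DifferentiableAt ℝ (fderiv ℝ u) (dropLast n p))
    (v : EuclideanSpace ℝ (Fin (n + 1))) :
    ⟪graphNormal u p, graphNormalDeriv u p v⟫ = 0 := by
  have h := hasFDerivAt_graphNormal hu
  have h1 := h.norm_sq
  have h2 : HasFDerivAt (fun p => ‖graphNormal u p‖ ^ 2) (0 : _ →L[ℝ] ℝ) p := by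
    simp only [norm_graphNormal]; exact hasFDerivAt_const _ _
  have := congr($(h1.unique h2) v)
  simpa using this

theorem inner_graphNormal (u : EuclideanSpace ℝ (Fin n) → ℝ)
    (p v : EuclideanSpace ℝ (Fin (n + 1))) :
    ⟪graphNormal u p, v⟫ = (areaFactor n (fderiv ℝ u (dropLast n p)))⁻¹ *
      (v (Fin.last n) - fderiv ℝ u (dropLast n p) (dropLast n v)) := by
  rw [graphNormal, real_inner_smul_left, inner_upNormal]

theorem mem_tangentSpaceOf_graphOf_iff_inner {u : EuclideanSpace ℝ (Fin n) → ℝ}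
    {p : EuclideanSpace ℝ (Fin (n + 1))} (hp : p ∈ graphOf u)
    (hu : DifferentiableAt ℝ u (dropLast n p)) (v : EuclideanSpace ℝ (Fin (n + 1))) :
    v ∈ tangentSpaceOf (graphOf u) p ↔ ⟪graphNormal u p, v⟫ = 0 := by
  rw [mem_tangentSpaceOf_graphOf hp hu, inner_graphNormal]
  have := (areaFactor_pos (fderiv ℝ u (dropLast n p))).ne'
  simp [sub_eq_zero, this]

theorem isUnitNormalField_graphNormal {u : EuclideanSpace ℝ (Fin n) → ℝ}
    (hu : Differentiable ℝ u) (hu' : Differentiable ℝ (fderiv ℝ u)) :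
    IsUnitNormalField (graphOf u) (graphNormal u) :=
  ⟨fun _ _ => (hasFDerivAt_graphNormal (hu' _)).continuousAt.continuousWithinAt,
    fun p hp => ⟨norm_graphNormal u p,
      fun _ hv => (mem_tangentSpaceOf_graphOf_iff_inner hp (hu _) _).1 hv⟩⟩

/-! ### Shape operator, second fundamental form and mean curvature of a graph -/

theorem shapeOperator_graphOf {u : EuclideanSpace ℝ (Fin n) → ℝ}
    {p : EuclideanSpace ℝ (Fin (n + 1))} (hp : p ∈ graphOf u)
    (hu : DifferentiableAt ℝ u (dropLast n p))
    (hu' : DifferentiableAt ℝ (fderiv ℝ u) (dropLast n p))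
    (v : tangentSpaceOf (graphOf u) p) :
    (shapeOperator (graphOf u) (graphNormal u) p v : EuclideanSpace ℝ (Fin (n + 1))) =
      - graphNormalDeriv u p v := by
  have h1 := fderivWithin_eq_of_isTangentVector (hasFDerivAt_graphNormal hu') v.2
  have h2 : graphNormalDeriv u p v ∈ tangentSpaceOf (graphOf u) p :=
    (mem_tangentSpaceOf_graphOf_iff_inner hp hu _).2 (inner_graphNormal_graphNormalDeriv hu' _)
  have h3 := (tangentSpaceOf (graphOf u) p).orthogonalProjectionOnto_mem_subspace_eq_self
    ⟨_, h2⟩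
  simp [shapeOperator, h1, h3]

/-- The part of the derivative of the normal that comes from differentiating its length factor is a
multiple of `upNormal`, so it is orthogonal to the tangent vector `w`. -/
theorem secondFundamentalForm_graphOf {u : EuclideanSpace ℝ (Fin n) → ℝ}
    {p : EuclideanSpace ℝ (Fin (n + 1))} (hp : p ∈ graphOf u)
    (hu : DifferentiableAt ℝ u (dropLast n p))
    (hu' : DifferentiableAt ℝ (fderiv ℝ u) (dropLast n p))
    (v w : tangentSpaceOf (graphOf u) p) :
    secondFundamentalForm (graphOf u) (graphNormal u) p v w =
      (areaFactor n (fderiv ℝ u (dropLast n p)))⁻¹ *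
        fderiv ℝ (fderiv ℝ u) (dropLast n p) (dropLast n v) (dropLast n w) := by
  have hw := (mem_tangentSpaceOf_graphOf hp hu _).1 w.2
  rw [secondFundamentalForm, Submodule.coe_inner, shapeOperator_graphOf hp hu hu']
  simp only [graphNormalDeriv, inner_neg_left, sub_apply,
    ContinuousLinearMap.smulRight_apply, inner_sub_left, real_inner_smul_left, inner_upNormal, hw,
    neg_apply, smul_apply,
    ContinuousLinearMap.comp_apply]
  rw [inner_eq_dropLast_add]
  simp [inner_rieszVec]

theorem abs_secondFundamentalForm_graphOf_le {u : EuclideanSpace ℝ (Fin n) → ℝ}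
    {p : EuclideanSpace ℝ (Fin (n + 1))} (hp : p ∈ graphOf u)
    (hu : DifferentiableAt ℝ u (dropLast n p))
    (hu' : DifferentiableAt ℝ (fderiv ℝ u) (dropLast n p)) {C : ℝ}
    (hC : ‖fderiv ℝ (fderiv ℝ u) (dropLast n p)‖ ≤ C)
    (v w : tangentSpaceOf (graphOf u) p) :
    |secondFundamentalForm (graphOf u) (graphNormal u) p v w| ≤ C * ‖v‖ * ‖w‖ := by
  have h0 := areaFactor_pos (fderiv ℝ u (dropLast n p))
  rw [secondFundamentalForm_graphOf hp hu hu', abs_mul, abs_of_pos (inv_pos.2 h0)]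
  have h1 := inv_le_one_of_one_le₀ (one_le_areaFactor (fderiv ℝ u (dropLast n p)))
  have h2 := (fderiv ℝ (fderiv ℝ u) (dropLast n p)).le_opNorm₂ (dropLast n v) (dropLast n w)
  have hv := norm_dropLast_le (v : EuclideanSpace ℝ (Fin (n + 1)))
  have hw := norm_dropLast_le (w : EuclideanSpace ℝ (Fin (n + 1)))
  rw [Real.norm_eq_abs] at h2
  have hC0 : 0 ≤ C := (norm_nonneg (fderiv ℝ (fderiv ℝ u) (dropLast n p))).trans hC
  calc _ ≤ 1 * |fderiv ℝ (fderiv ℝ u) (dropLast n p) (dropLast n v) (dropLast n w)| := by gcongr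
    _ ≤ ‖fderiv ℝ (fderiv ℝ u) (dropLast n p)‖ * ‖dropLast n v‖ * ‖dropLast n w‖ := by
      rw [one_mul]; exact h2
    _ ≤ C * ‖v‖ * ‖w‖ := by
      change _ ≤ C * ‖(v : EuclideanSpace ℝ (Fin (n + 1)))‖ * ‖(w : EuclideanSpace ℝ (Fin (n + 1)))‖
      gcongr

theorem laplacian_eq_sum_fderiv (u : EuclideanSpace ℝ (Fin n) → ℝ) (x : EuclideanSpace ℝ (Fin n)) :
    Δ u x = ∑ i, fderiv ℝ (fderiv ℝ u) x (EuclideanSpace.single i 1)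
      (EuclideanSpace.single i 1) := by
  simp [InnerProductSpace.laplacian_eq_iteratedFDeriv_orthonormalBasis u
    (EuclideanSpace.basisFun (Fin n) ℝ), iteratedFDeriv_two_apply]

theorem trace_rieszVec_comp (A : EuclideanSpace ℝ (Fin n) →L[ℝ] EuclideanSpace ℝ (Fin n) →L[ℝ] ℝ) :
    LinearMap.trace ℝ _ (rieszVec n ∘L A).toLinearMap =
      ∑ i, A (EuclideanSpace.single i 1) (EuclideanSpace.single i 1) := by
  rw [LinearMap.trace_eq_sum_inner _ (EuclideanSpace.basisFun (Fin n) ℝ)]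
  refine Finset.sum_congr rfl fun i _ => ?_
  rw [real_inner_comm]
  simp only [EuclideanSpace.basisFun_apply, ContinuousLinearMap.coe_coe,
    ContinuousLinearMap.comp_apply, inner_rieszVec]

theorem meanCurvature_graphOf {u : EuclideanSpace ℝ (Fin n) → ℝ}
    {p : EuclideanSpace ℝ (Fin (n + 1))} (hp : p ∈ graphOf u)
    (hu : DifferentiableAt ℝ u (dropLast n p))
    (hu' : DifferentiableAt ℝ (fderiv ℝ u) (dropLast n p)) :
    meanCurvature (graphOf u) (graphNormal u) p =
      (areaFactor n (fderiv ℝ u (dropLast n p)))⁻¹ * Δ u (dropLast n p) -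
        (areaFactor n (fderiv ℝ u (dropLast n p)) ^ 3)⁻¹ *
          fderiv ℝ (fderiv ℝ u) (dropLast n p) (rieszVec n (fderiv ℝ u (dropLast n p)))
            (rieszVec n (fderiv ℝ u (dropLast n p))) := by
  set T := tangentSpaceOf (graphOf u) p
  have hmem (v) : (-graphNormalDeriv u p).toLinearMap v ∈ T := T.neg_mem <|
    (mem_tangentSpaceOf_graphOf_iff_inner hp hu _).2 (inner_graphNormal_graphNormalDeriv hu' _)
  -- The derivative of the extended normal maps the whole space into `T`. Cyclicity of the trace
  -- therefore replaces the trace on `T` by the trace on `ℝ^(n+1)`, and no basis of `T` is needed.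
  have h1 : (shapeOperator (graphOf u) (graphNormal u) p).toLinearMap =
      ((-graphNormalDeriv u p).toLinearMap.codRestrict T hmem) ∘ₗ T.subtype := by
    ext1 v
    exact Subtype.ext (shapeOperator_graphOf hp hu hu' v)
  have h2 : T.subtype ∘ₗ ((-graphNormalDeriv u p).toLinearMap.codRestrict T hmem) =
      (-graphNormalDeriv u p).toLinearMap := by
    ext1 v; rfl
  rw [meanCurvature, h1, LinearMap.trace_comp_comm', h2, laplacian_eq_sum_fderiv,
    ← trace_rieszVec_comp]
  have h3 : LinearMap.trace ℝ _
      (padZero n ∘L (rieszVec n ∘L fderiv ℝ (fderiv ℝ u) (dropLast n p)) ∘L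
        dropLast n).toLinearMap =
      LinearMap.trace ℝ _ (rieszVec n ∘L fderiv ℝ (fderiv ℝ u) (dropLast n p)).toLinearMap := by
    rw [ContinuousLinearMap.toLinearMap_comp, LinearMap.trace_comp_comm']
    congr 1
    ext1 v
    simp
  have h4 (φ : EuclideanSpace ℝ (Fin (n + 1)) →L[ℝ] ℝ) (w : EuclideanSpace ℝ (Fin (n + 1))) :
      LinearMap.trace ℝ _ (φ.smulRight w).toLinearMap = φ w :=
    LinearMap.trace_smulRight φ.toLinearMap w
  simp only [graphNormalDeriv, ContinuousLinearMap.toLinearMap_neg,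
    ContinuousLinearMap.toLinearMap_sub, ContinuousLinearMap.toLinearMap_smul, map_neg, map_sub,
    map_smul, h3, h4]
  simp
  ring

/-! ### Regularity of a graph as a hypersurface -/

theorem isTwiceDifferentiableHypersurface_graphOf {u : EuclideanSpace ℝ (Fin n) → ℝ}
    (hu : Differentiable ℝ u) (hu' : Differentiable ℝ (fderiv ℝ u)) :
    IsTwiceDifferentiableHypersurface (graphOf u) := by
  intro p _
  have hF (q) : HasFDerivAt (fun q => q (Fin.last n) - u (dropLast n q))
      (lastCoord n - fderiv ℝ u (dropLast n q) ∘L dropLast n) q :=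
    (lastCoord n).hasFDerivAt.sub ((hu _).hasFDerivAt.comp q (dropLast n).hasFDerivAt)
  refine ⟨Set.univ, fun q => q (Fin.last n) - u (dropLast n q), isOpen_univ, trivial,
    ⟨fun q _ => (hF q).differentiableAt.differentiableWithinAt, ?_⟩, fun q _ h => ?_, ?_⟩
  · rw [funext fun q => (hF q).fderiv]
    refine Differentiable.differentiableOn ?_
    exact (differentiable_const _).sub
      ((hu'.comp (dropLast n).differentiable).clm_comp (differentiable_const _))
  · rw [(hF q).fderiv] at h
    simpa using congr($h (lastVec n))
  · ext q
    simp [mem_graphOf, sub_eq_zero]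

/-- If the graph of `u` is a hypersurface of class `C^2`, then the second derivative of `u` is
continuous. -/
theorem IsC2Hypersurface.continuous_fderiv_fderiv {u : EuclideanSpace ℝ (Fin n) → ℝ}
    (h : IsC2Hypersurface (graphOf u)) (hu : Differentiable ℝ u)
    (hu' : Differentiable ℝ (fderiv ℝ u)) : Continuous (fderiv ℝ (fderiv ℝ u)) := by
  rw [continuous_iff_continuousAt]
  intro x
  obtain ⟨U, F, hU, hxU, hF, hF0, hFU⟩ := h (graphPoint u x) (graphPoint_mem u x)
  have hg : Continuous (graphPoint u) :=
    continuous_iff_continuousAt.2 fun y => (hasFDerivAt_graphPoint (hu y)).continuousAt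
  have hgU : ∀ᶠ y in 𝓝 x, graphPoint u y ∈ U := hg.continuousAt (hU.mem_nhds hxU)
  have hzero : ∀ᶠ y in 𝓝 x, F (graphPoint u y) = 0 := hgU.mono fun y hy =>
    (hFU ▸ (⟨graphPoint_mem u y, hy⟩ : graphPoint u y ∈ graphOf u ∩ U) :
      graphPoint u y ∈ {q ∈ U | F q = 0}).2
  -- Differentiate `F (y, u y) = 0` with respect to `y`.
  have hchain : ∀ᶠ y in 𝓝 x, fderiv ℝ F (graphPoint u y) ∘L padZero n =
      -(fderiv ℝ F (graphPoint u y) (lastVec n) • fderiv ℝ u y) := by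
    filter_upwards [hgU, hzero.eventually_nhds] with y hyU hy
    have h1 : HasFDerivAt F (fderiv ℝ F (graphPoint u y)) (graphPoint u y) :=
      ((hF.contDiffAt (hU.mem_nhds hyU)).differentiableAt (by norm_num)).hasFDerivAt
    have h2 := h1.comp y (hasFDerivAt_graphPoint (hu y))
    have h3 := h2.unique ((hasFDerivAt_const (0 : ℝ) y).congr_of_eventuallyEq hy)
    ext w
    have h4 := congr($h3 w)
    simp only [ContinuousLinearMap.comp_apply, add_apply, map_add,
      ContinuousLinearMap.smulRight_apply, map_smul, zero_apply,
      smul_eq_mul] at h4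
    simp only [ContinuousLinearMap.comp_apply, neg_apply,
      smul_apply, smul_eq_mul]
    linarith
  -- If the vertical derivative of `F` vanished, `hchain` would kill the horizontal ones as well.
  have hlast : fderiv ℝ F (graphPoint u x) (lastVec n) ≠ 0 := by
    intro h0
    refine hF0 _ hxU ?_
    ext v
    have h1 := hchain.self_of_nhds
    rw [h0, zero_smul, neg_zero] at h1
    have h2 := congr($h1 (dropLast n v))
    rw [← padZero_dropLast_add v, map_add, map_smul, h0]
    simpa using h2
  have hu1 : ContDiff ℝ 1 u := contDiff_one_iff_fderiv.2 ⟨hu, hu'.continuous⟩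
  have hg1 : ContDiffAt ℝ 1 (graphPoint u) x :=
    ((padZero n).contDiff.add (hu1.smul contDiff_const)).contDiffAt
  have hF1 : ContDiffAt ℝ 1 (fun y => fderiv ℝ F (graphPoint u y)) x :=
    ((hF.contDiffAt (hU.mem_nhds hxU)).fderiv_right (m := 1) (by norm_num)).comp x hg1
  -- Solve `hchain` for `Du`. Since `u` is already `C¹`, the map `y ↦ DF (y, u y)` is `C¹`, and so
  -- is the quotient.
  have hu2 : ContDiffAt ℝ 1 (fderiv ℝ u) x := by
    have h1 : ContDiffAt ℝ 1 (fun y => -((fderiv ℝ F (graphPoint u y) (lastVec n))⁻¹ •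
        (fderiv ℝ F (graphPoint u y) ∘L padZero n))) x :=
      (((hF1.clm_apply contDiffAt_const).inv hlast).smul (hF1.clm_comp contDiffAt_const)).neg
    refine h1.congr_of_eventuallyEq ?_
    have h2 := (hF1.clm_apply (contDiffAt_const (c := lastVec n))).continuousAt.eventually_ne hlast
    filter_upwards [hchain, h2] with y hy hy0
    rw [hy, smul_neg, neg_neg, smul_smul, inv_mul_cancel₀ hy0, one_smul]
  exact (hu2.fderiv_right (m := 0) (by norm_num)).continuousAt

/-! ### Logarithmic cut-offs -/

/-- Cut-off functions `h` of logarithmic type: they equal `1` at `0` and vanish beyond `r ^ 2`, and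
yet `s h'(s)` and `s ^ 2 h''(s)` are as small as one likes. -/
theorem exists_log_cutoff : ∃ M : ℝ, 0 ≤ M ∧ ∀ ε : ℝ, 0 < ε → ε ≤ 1 → ∀ r : ℝ, 0 < r →
    ∃ h h' h'' : ℝ → ℝ, h 0 = 1 ∧ (∀ s, r ^ 2 ≤ s → h s = 0) ∧
      ∀ s, 0 ≤ s → ContDiffAt ℝ 2 h s ∧ HasDerivAt h (h' s) s ∧ HasDerivAt h' (h'' s) s ∧
        |h s| ≤ 1 ∧ s * |h' s| ≤ M * ε ∧ s ^ 2 * |h'' s| ≤ M * ε := by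
  -- `χ` is 1 near -1 and vanishes on `[0, ∞)`. The cut-off is `χ ∘ L`, where `L` is `ε` times a
  -- shifted logarithm.
  let χ : ContDiffBump (-1 : ℝ) := ⟨1 / 2, 1, by norm_num, by norm_num⟩
  have hχ : ContDiff ℝ 2 χ := χ.contDiff
  have hχ1 : ContDiff ℝ 1 (deriv χ) := hχ.deriv'
  have hχ2 : Continuous (deriv (deriv χ)) := hχ1.continuous_deriv le_rfl
  obtain ⟨M₁, hM₁⟩ := hχ1.continuous.bounded_above_of_compact_support χ.hasCompactSupport.deriv
  obtain ⟨M₂, hM₂⟩ := hχ2.bounded_above_of_compact_support χ.hasCompactSupport.deriv.deriv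
  simp only [Real.norm_eq_abs] at hM₁ hM₂
  have hM₁0 : 0 ≤ M₁ := (abs_nonneg _).trans (hM₁ 0)
  have hM₂0 : 0 ≤ M₂ := (abs_nonneg _).trans (hM₂ 0)
  refine ⟨M₁ + M₂, by positivity, fun ε hε hε1 r hr => ?_⟩
  -- The shift `δ` keeps the logarithm smooth at `s = 0`, and its value makes `L 0 = -1`. Positivity
  -- of `δ` gives `L s ≥ 0` once `s ≥ r ^ 2`.
  set δ : ℝ := r ^ 2 * Real.exp (-(1 / ε)) with hδ
  have hδ0 : 0 < δ := by positivity
  set L : ℝ → ℝ := fun s => ε * (Real.log (s + δ) - Real.log (r ^ 2)) with hL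
  have hLd (s : ℝ) (hs : 0 ≤ s) : HasDerivAt L (ε / (s + δ)) s := by
    have h1 := ((((hasDerivAt_id s).add_const δ).log (by simp; positivity)).sub_const
      (Real.log (r ^ 2))).const_mul ε
    refine h1.congr_deriv ?_
    simp [div_eq_mul_inv]
  have hχd (t : ℝ) : HasDerivAt χ (deriv χ t) t :=
    ((hχ.differentiable (by norm_num)) t).hasDerivAt
  have hχd' (t : ℝ) : HasDerivAt (deriv χ) (deriv (deriv χ) t) t :=
    ((hχ1.differentiable (by norm_num)) t).hasDerivAt
  refine ⟨fun s => χ (L s), fun s => deriv χ (L s) * (ε / (s + δ)),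
    fun s => deriv (deriv χ) (L s) * (ε / (s + δ)) * (ε / (s + δ)) +
      deriv χ (L s) * (-ε / (s + δ) ^ 2), ?_, fun s hs => ?_, fun s hs => ⟨?_, ?_, ?_, ?_, ?_, ?_⟩⟩
  · have : L 0 = -1 := by
      simp only [hL, zero_add, hδ]
      rw [Real.log_mul (by positivity) (by positivity), Real.log_exp]
      field_simp
      ring
    simp only [this]
    exact χ.one_of_mem_closedBall (by simp [χ])
  · refine χ.zero_of_le_dist ?_
    have h1 : Real.log (r ^ 2) ≤ Real.log (s + δ) :=
      Real.log_le_log (by positivity) (by linarith)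
    have h2 : 0 ≤ L s := mul_nonneg hε.le (by linarith)
    rw [Real.dist_eq, abs_of_nonneg (by linarith)]
    change 1 ≤ _
    linarith
  · refine hχ.contDiffAt.comp s ?_
    exact contDiffAt_const.mul (((contDiffAt_id.add contDiffAt_const).log
      (by simp; positivity)).sub contDiffAt_const)
  · exact (hχd _).comp s (hLd s hs)
  · have h1 := (hχd' _).comp s (hLd s hs)
    have h2 : HasDerivAt (fun s => ε / (s + δ)) (-ε / (s + δ) ^ 2) s := by
      have := (hasDerivAt_const s ε).div ((hasDerivAt_id s).add_const δ) (by simp; positivity)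
      refine this.congr_deriv ?_
      simp
    exact h1.mul h2
  · rw [abs_of_nonneg χ.nonneg]; exact χ.le_one
  · have hs' : s / (s + δ) ≤ 1 := div_le_one_of_le₀ (by linarith) (by positivity)
    rw [abs_mul, abs_of_nonneg (by positivity : 0 ≤ ε / (s + δ))]
    calc s * (|deriv χ (L s)| * (ε / (s + δ))) = |deriv χ (L s)| * ε * (s / (s + δ)) := by ring
      _ ≤ M₁ * ε * 1 := by gcongr; exact hM₁ _
      _ ≤ (M₁ + M₂) * ε := by nlinarith
  · have hs0 : 0 ≤ s / (s + δ) := by positivity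
    have hs' : s / (s + δ) ≤ 1 := div_le_one_of_le₀ (by linarith) (by positivity)
    have hsq : (s / (s + δ)) ^ 2 ≤ 1 := pow_le_one₀ hs0 hs'
    -- Each derivative of `L` costs a factor `1 / (s + δ)`, which the powers of `s` absorb; one
    -- factor `ε` remains in front.
    have e : s ^ 2 * |deriv (deriv χ) (L s) * (ε / (s + δ)) * (ε / (s + δ)) +
        deriv χ (L s) * (-ε / (s + δ) ^ 2)| =
        (s / (s + δ)) ^ 2 * ε * |deriv (deriv χ) (L s) * ε - deriv χ (L s)| := by
      rw [← abs_of_nonneg (by positivity : 0 ≤ s ^ 2),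
        ← abs_of_nonneg (by positivity : 0 ≤ (s / (s + δ)) ^ 2 * ε), ← abs_mul, ← abs_mul]
      congr 1
      have : s + δ ≠ 0 := by positivity
      field_simp
      ring
    rw [e]
    have h3 : |deriv (deriv χ) (L s) * ε - deriv χ (L s)| ≤ M₁ + M₂ := by
      refine (abs_sub _ _).trans ?_
      rw [abs_mul, abs_of_pos hε]
      have := mul_le_of_le_one_right (abs_nonneg (deriv (deriv χ) (L s))) hε1
      linarith [hM₁ (L s), hM₂ (L s)]
    calc _ ≤ 1 * ε * (M₁ + M₂) := by gcongr
      _ = _ := by ring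

/-! ### Saddles multiplied by a radial cut-off -/

/-- The inner product of `ℝ^n` as a continuous bilinear map. -/
noncomputable def innerCLM (n : ℕ) :
    EuclideanSpace ℝ (Fin n) →L[ℝ] EuclideanSpace ℝ (Fin n) →L[ℝ] ℝ :=
  LinearMap.mkContinuous₂ (innerₗ (EuclideanSpace ℝ (Fin n))) 1 fun x y => by
    simpa using abs_real_inner_le_norm x y

@[simp] theorem innerCLM_apply (x y : EuclideanSpace ℝ (Fin n)) : innerCLM n x y = ⟪x, y⟫ := by
  simp [innerCLM]

theorem hasFDerivAt_norm_sq (x : EuclideanSpace ℝ (Fin n)) :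
    HasFDerivAt (fun x => ‖x‖ ^ 2) ((2 : ℝ) • innerCLM n x) x := by
  refine (hasStrictFDerivAt_norm_sq x).hasFDerivAt.congr_fderiv ?_
  ext y
  simp

/-- The `i`-th coordinate of `ℝ^n`. -/
noncomputable abbrev coordCLM (i : Fin n) : EuclideanSpace ℝ (Fin n) →L[ℝ] ℝ :=
  EuclideanSpace.proj i

/-- The derivative of `x ↦ x i * x j` as a function of `x`. -/
noncomputable def saddleDeriv (i j : Fin n) :
    EuclideanSpace ℝ (Fin n) →L[ℝ] EuclideanSpace ℝ (Fin n) →L[ℝ] ℝ :=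
  (coordCLM j).smulRight (coordCLM i) + (coordCLM i).smulRight (coordCLM j)

@[simp] theorem saddleDeriv_apply (i j : Fin n) (x y : EuclideanSpace ℝ (Fin n)) :
    saddleDeriv i j x y = x j * y i + x i * y j := by
  simp [saddleDeriv]

theorem hasFDerivAt_saddle (i j : Fin n) (x : EuclideanSpace ℝ (Fin n)) :
    HasFDerivAt (fun x => x i * x j) (saddleDeriv i j x) x := by
  refine ((coordCLM i).hasFDerivAt.mul (coordCLM j).hasFDerivAt).congr_fderiv ?_
  ext y
  simp
  ring

theorem abs_coord_le (x : EuclideanSpace ℝ (Fin n)) (i : Fin n) : |x i| ≤ ‖x‖ := by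
  simpa using PiLp.norm_apply_le x i

section SaddleBump

variable {i j : Fin n} {h h' h'' : ℝ → ℝ}

theorem hasFDerivAt_saddle_mul {x : EuclideanSpace ℝ (Fin n)}
    (hh : HasDerivAt h (h' (‖x‖ ^ 2)) (‖x‖ ^ 2)) :
    HasFDerivAt (fun x => x i * x j * h (‖x‖ ^ 2))
      (h (‖x‖ ^ 2) • saddleDeriv i j x + (2 * (x i * x j) * h' (‖x‖ ^ 2)) • innerCLM n x) x := by
  refine ((hasFDerivAt_saddle i j x).mul
    (hh.comp_hasFDerivAt x (hasFDerivAt_norm_sq x))).congr_fderiv ?_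
  ext y
  simp
  ring

theorem fderiv_fderiv_saddle_mul
    (hh : ∀ s, 0 ≤ s → HasDerivAt h (h' s) s) (hh' : ∀ s, 0 ≤ s → HasDerivAt h' (h'' s) s)
    (x a b : EuclideanSpace ℝ (Fin n)) :
    fderiv ℝ (fderiv ℝ fun x : EuclideanSpace ℝ (Fin n) => x i * x j * h (‖x‖ ^ 2)) x a b =
      h (‖x‖ ^ 2) * (a j * b i + a i * b j) +
      2 * h' (‖x‖ ^ 2) * (⟪x, a⟫ * (x j * b i + x i * b j) + (x j * a i + x i * a j) * ⟪x, b⟫ +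
        x i * x j * ⟪a, b⟫) + 4 * h'' (‖x‖ ^ 2) * (x i * x j) * ⟪x, a⟫ * ⟪x, b⟫ := by
  have hs : 0 ≤ ‖x‖ ^ 2 := by positivity
  rw [funext fun x : EuclideanSpace ℝ (Fin n) =>
    (hasFDerivAt_saddle_mul (i := i) (j := j) (hh (‖x‖ ^ 2) (by positivity))).fderiv]
  have h1 := ((hh _ hs).comp_hasFDerivAt x (hasFDerivAt_norm_sq x)).smul
    (saddleDeriv i j).hasFDerivAt
  have h2 := ((((hasFDerivAt_saddle i j x).const_mul 2).mul
    ((hh' _ hs).comp_hasFDerivAt x (hasFDerivAt_norm_sq x))).smul (innerCLM n).hasFDerivAt)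
  have h3 := (h1.add h2).fderiv
  have h4 := congr($h3 a b)
  refine h4.trans ?_
  simp
  ring

/-- The saddle is harmonic, so the undifferentiated `h` drops out. By homogeneity of degree 2 the
cross term gives `8 h'`, and the Laplacian of `h (‖x‖ ^ 2)` gives `2 n h' + 4 ‖x‖² h''`. -/
theorem laplacian_saddle_mul (hij : i ≠ j)
    (hh : ∀ s, 0 ≤ s → HasDerivAt h (h' s) s) (hh' : ∀ s, 0 ≤ s → HasDerivAt h' (h'' s) s)
    (x : EuclideanSpace ℝ (Fin n)) :
    (Δ fun x : EuclideanSpace ℝ (Fin n) => x i * x j * h (‖x‖ ^ 2)) x =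
      x i * x j * ((2 * n + 8) * h' (‖x‖ ^ 2) + 4 * ‖x‖ ^ 2 * h'' (‖x‖ ^ 2)) := by
  rw [laplacian_eq_sum_fderiv]
  simp only [fderiv_fderiv_saddle_mul hh hh']
  have e : ‖x‖ ^ 2 = ∑ k, x k ^ 2 := EuclideanSpace.real_norm_sq_eq x
  -- The diagonal entries of the Hessian of the saddle vanish; this is where `i ≠ j` enters.
  have h1 (k : Fin n) : (EuclideanSpace.single k (1 : ℝ) : EuclideanSpace ℝ (Fin n)) j *
      (EuclideanSpace.single k (1 : ℝ) : EuclideanSpace ℝ (Fin n)) i = 0 := by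
    by_cases hk : k = i
    · subst hk; simp [hij.symm]
    · simp [Ne.symm hk]
  have h2 (k : Fin n) : x k * (EuclideanSpace.single k (1 : ℝ) : EuclideanSpace ℝ (Fin n)) i =
      if k = i then x i else 0 := by
    by_cases hk : k = i
    · subst hk; simp
    · simp [Ne.symm hk, hk]
  have h3 (k : Fin n) : x k * (EuclideanSpace.single k (1 : ℝ) : EuclideanSpace ℝ (Fin n)) j =
      if k = j then x j else 0 := by
    by_cases hk : k = j
    · subst hk; simp
    · simp [Ne.symm hk, hk]
  have h4 (k : Fin n) : ⟪x, EuclideanSpace.single k (1 : ℝ)⟫ = x k := by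
    simp [EuclideanSpace.inner_single_right]
  have h5 (k : Fin n) : ⟪(EuclideanSpace.single k (1 : ℝ) : EuclideanSpace ℝ (Fin n)),
      EuclideanSpace.single k (1 : ℝ)⟫ = 1 := by simp
  set H := h (‖x‖ ^ 2)
  set H' := h' (‖x‖ ^ 2)
  set H'' := h'' (‖x‖ ^ 2)
  have h6 (k : Fin n) : H * ((EuclideanSpace.single k (1 : ℝ) : EuclideanSpace ℝ (Fin n)) j *
      (EuclideanSpace.single k (1 : ℝ) : EuclideanSpace ℝ (Fin n)) i +
      (EuclideanSpace.single k (1 : ℝ) : EuclideanSpace ℝ (Fin n)) i *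
      (EuclideanSpace.single k (1 : ℝ) : EuclideanSpace ℝ (Fin n)) j) +
      2 * H' * (⟪x, EuclideanSpace.single k (1 : ℝ)⟫ *
        (x j * (EuclideanSpace.single k (1 : ℝ) : EuclideanSpace ℝ (Fin n)) i +
          x i * (EuclideanSpace.single k (1 : ℝ) : EuclideanSpace ℝ (Fin n)) j) +
        (x j * (EuclideanSpace.single k (1 : ℝ) : EuclideanSpace ℝ (Fin n)) i +
          x i * (EuclideanSpace.single k (1 : ℝ) : EuclideanSpace ℝ (Fin n)) j) *
          ⟪x, EuclideanSpace.single k (1 : ℝ)⟫ +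
        x i * x j * ⟪(EuclideanSpace.single k (1 : ℝ) : EuclideanSpace ℝ (Fin n)),
          EuclideanSpace.single k (1 : ℝ)⟫) +
      4 * H'' * (x i * x j) * ⟪x, EuclideanSpace.single k (1 : ℝ)⟫ *
        ⟪x, EuclideanSpace.single k (1 : ℝ)⟫ =
      4 * H' * x j * (if k = i then x i else 0) + 4 * H' * x i * (if k = j then x j else 0) +
        2 * H' * (x i * x j) + 4 * H'' * (x i * x j) * x k ^ 2 := by
    rw [h4, h5, ← h2, ← h3]
    linear_combination 2 * H * h1 k
  rw [Finset.sum_congr rfl fun k _ => h6 k]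
  simp only [Finset.sum_add_distrib, ← Finset.mul_sum, ← e, Finset.sum_ite_eq', Finset.mem_univ,
    if_true, Finset.sum_const, Finset.card_univ, Fintype.card_fin, nsmul_eq_mul]
  ring

end SaddleBump

/-- Functions with small support, bounded second derivative and small Laplacian, but with a second
derivative at `0` that is not small. -/
theorem exists_saddle_bump {i j : Fin n} (hij : i ≠ j) : ∃ C : ℝ, ∀ ε : ℝ, 0 < ε → ε ≤ 1 →
    ∀ r : ℝ, 0 < r → ∃ w : EuclideanSpace ℝ (Fin n) → ℝ, ContDiff ℝ 2 w ∧
      (∀ x, r ≤ ‖x‖ → w x = 0) ∧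
      fderiv ℝ (fderiv ℝ w) 0 (EuclideanSpace.single i 1) (EuclideanSpace.single j 1) = 1 ∧
      ∀ x, |w x| ≤ C * ‖x‖ ^ 2 ∧ ‖fderiv ℝ w x‖ ≤ C * ‖x‖ ∧ ‖fderiv ℝ (fderiv ℝ w) x‖ ≤ C ∧
        |Δ w x| ≤ C * ε := by
  obtain ⟨M, hM, H⟩ := exists_log_cutoff
  -- One constant for all four bounds: the Hessian needs `2 + 14 M` and the Laplacian `(2 n + 12)
  -- M`.
  refine ⟨2 + (2 * n + 14) * M, fun ε hε hε1 r hr => ?_⟩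
  obtain ⟨h, h', h'', h0, hr0, hh⟩ := H ε hε hε1 r hr
  have hd (s : ℝ) (hs : 0 ≤ s) : HasDerivAt h (h' s) s := (hh s hs).2.1
  have hd' (s : ℝ) (hs : 0 ≤ s) : HasDerivAt h' (h'' s) s := (hh s hs).2.2.1
  have hnM : 0 ≤ (n : ℝ) * M := by positivity
  have hMε : M * ε ≤ M := mul_le_of_le_one_right hM hε1
  refine ⟨fun x => x i * x j * h (‖x‖ ^ 2), ?_, fun x hx => ?_, ?_, fun x => ?_⟩
  · refine contDiff_iff_contDiffAt.2 fun x => ?_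
    refine ((coordCLM i).contDiff.mul (coordCLM j).contDiff).contDiffAt.mul ?_
    exact (hh (‖x‖ ^ 2) (by positivity)).1.comp x (contDiff_norm_sq ℝ).contDiffAt
  · simp only
    rw [hr0 _ (by gcongr), mul_zero]
  · rw [fderiv_fderiv_saddle_mul hd hd']
    simp [h0, hij, hij.symm]
  obtain ⟨-, -, -, b0, b1, b2⟩ := hh (‖x‖ ^ 2) (by positivity)
  have hxi := abs_coord_le x i
  have hxj := abs_coord_le x j
  have hN := norm_nonneg x
  have hxx : |x i * x j| ≤ ‖x‖ ^ 2 := by rw [abs_mul, sq]; gcongr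
  have hsd (b : EuclideanSpace ℝ (Fin n)) : |x j * b i + x i * b j| ≤ 2 * (‖x‖ * ‖b‖) := by
    refine (abs_add_le _ _).trans ?_
    rw [abs_mul, abs_mul, two_mul]
    gcongr <;> exact abs_coord_le b _
  have hab (a b : EuclideanSpace ℝ (Fin n)) : |a j * b i + a i * b j| ≤ 2 * (‖a‖ * ‖b‖) := by
    refine (abs_add_le _ _).trans ?_
    rw [abs_mul, abs_mul, two_mul]
    gcongr <;> exact abs_coord_le _ _
  refine ⟨?_, ?_, ?_, ?_⟩
  · rw [abs_mul]
    calc _ ≤ ‖x‖ ^ 2 * 1 := by gcongr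
      _ ≤ _ := by nlinarith [mul_nonneg hnM (sq_nonneg ‖x‖), mul_nonneg hM (sq_nonneg ‖x‖)]
  · rw [(hasFDerivAt_saddle_mul (hd (‖x‖ ^ 2) (by positivity))).fderiv]
    refine ContinuousLinearMap.opNorm_le_bound _ (by positivity) fun b => ?_
    simp only [add_apply, smul_apply, smul_eq_mul, saddleDeriv_apply, innerCLM_apply,
      Real.norm_eq_abs]
    calc |h (‖x‖ ^ 2) * (x j * b i + x i * b j) + 2 * (x i * x j) * h' (‖x‖ ^ 2) * ⟪x, b⟫|
        ≤ |h (‖x‖ ^ 2)| * |x j * b i + x i * b j| +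
          2 * |x i * x j| * |h' (‖x‖ ^ 2)| * |⟪x, b⟫| := by
          refine (abs_add_le _ _).trans (le_of_eq ?_)
          simp only [abs_mul, abs_two]
      _ ≤ 1 * (2 * (‖x‖ * ‖b‖)) + 2 * ‖x‖ ^ 2 * |h' (‖x‖ ^ 2)| * (‖x‖ * ‖b‖) := by
          gcongr
          · exact hsd b
          · exact abs_real_inner_le_norm x b
      _ = (2 + 2 * (‖x‖ ^ 2 * |h' (‖x‖ ^ 2)|)) * (‖x‖ * ‖b‖) := by ring
      _ ≤ (2 + (2 * n + 14) * M) * (‖x‖ * ‖b‖) := by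
          have : 0 ≤ ‖x‖ * ‖b‖ := by positivity
          refine mul_le_mul_of_nonneg_right ?_ this
          nlinarith
      _ = _ := by ring
  · refine ContinuousLinearMap.opNorm_le_bound₂ _ (by positivity) fun a b => ?_
    rw [fderiv_fderiv_saddle_mul hd hd', Real.norm_eq_abs]
    calc _ ≤ |h (‖x‖ ^ 2)| * |a j * b i + a i * b j| +
          2 * |h' (‖x‖ ^ 2)| * (|⟪x, a⟫| * |x j * b i + x i * b j| +
            |x j * a i + x i * a j| * |⟪x, b⟫| + |x i * x j| * |⟪a, b⟫|) +
          4 * |h'' (‖x‖ ^ 2)| * |x i * x j| * |⟪x, a⟫| * |⟪x, b⟫| := by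
          refine (abs_add_three _ _ _).trans
            (add_le_add (add_le_add (abs_mul _ _).le ?_) (le_of_eq ?_))
          · rw [abs_mul, abs_mul, abs_two]
            gcongr
            refine (abs_add_three _ _ _).trans (le_of_eq ?_)
            rw [abs_mul, abs_mul, abs_mul (x i * x j)]
          · rw [abs_mul, abs_mul, abs_mul, abs_mul, abs_of_pos (by norm_num : (0 : ℝ) < 4)]
      _ ≤ 1 * (2 * (‖a‖ * ‖b‖)) + 2 * |h' (‖x‖ ^ 2)| * ((‖x‖ * ‖a‖) * (2 * (‖x‖ * ‖b‖)) +
            2 * (‖x‖ * ‖a‖) * (‖x‖ * ‖b‖) + ‖x‖ ^ 2 * (‖a‖ * ‖b‖)) +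
          4 * |h'' (‖x‖ ^ 2)| * ‖x‖ ^ 2 * (‖x‖ * ‖a‖) * (‖x‖ * ‖b‖) := by
          gcongr <;> first
            | exact abs_real_inner_le_norm _ _
            | exact hsd _
            | exact hab _ _
      _ = (2 + 10 * (‖x‖ ^ 2 * |h' (‖x‖ ^ 2)|) + 4 * ((‖x‖ ^ 2) ^ 2 * |h'' (‖x‖ ^ 2)|)) *
          (‖a‖ * ‖b‖) := by ring
      _ ≤ (2 + (2 * n + 14) * M) * (‖a‖ * ‖b‖) := by
          have : 0 ≤ ‖a‖ * ‖b‖ := by positivity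
          refine mul_le_mul_of_nonneg_right ?_ this
          nlinarith
      _ = _ := by ring
  · rw [laplacian_saddle_mul hij hd hd', abs_mul]
    calc _ ≤ ‖x‖ ^ 2 * ((2 * n + 8) * |h' (‖x‖ ^ 2)| + 4 * ‖x‖ ^ 2 * |h'' (‖x‖ ^ 2)|) := by
          gcongr
          refine (abs_add_le _ _).trans (le_of_eq ?_)
          rw [abs_mul, abs_mul, abs_of_nonneg (by positivity : 0 ≤ 2 * (n : ℝ) + 8),
            abs_of_nonneg (by positivity : 0 ≤ 4 * ‖x‖ ^ 2)]
      _ = (2 * n + 8) * (‖x‖ ^ 2 * |h' (‖x‖ ^ 2)|) +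
          4 * ((‖x‖ ^ 2) ^ 2 * |h'' (‖x‖ ^ 2)|) := by ring
      _ ≤ (2 * n + 8) * (M * ε) + 4 * (M * ε) := by gcongr
      _ ≤ _ := by nlinarith [mul_nonneg hM hε.le]

/-! ### Superposition of bumps that accumulate at the origin -/

/-- The points `2⁻ᵏ eᵢ`. -/
noncomputable def bumpCenter (i : Fin n) (k : ℕ) : EuclideanSpace ℝ (Fin n) :=
  ((1 / 2 : ℝ) ^ k) • EuclideanSpace.single i 1

/-- Radii of disjoint balls around the points `2⁻ᵏ eᵢ`. -/
noncomputable def bumpRadius (k : ℕ) : ℝ := ((1 / 2 : ℝ) ^ k) ^ 2 / 4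

theorem bumpRadius_pos (k : ℕ) : 0 < bumpRadius k := by
  rw [bumpRadius]; positivity

theorem half_pow_le_one (k : ℕ) : (1 / 2 : ℝ) ^ k ≤ 1 :=
  pow_le_one₀ (by norm_num) (by norm_num)

theorem bumpRadius_le (k : ℕ) : bumpRadius k ≤ (1 / 2 : ℝ) ^ k / 4 := by
  rw [bumpRadius]
  have h0 : 0 ≤ (1 / 2 : ℝ) ^ k := by positivity
  nlinarith [half_pow_le_one k]

theorem norm_bumpCenter (i : Fin n) (k : ℕ) : ‖bumpCenter i k‖ = (1 / 2 : ℝ) ^ k := by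
  simp [bumpCenter, norm_smul]

theorem norm_bounds_of_mem_ball {i : Fin n} {k : ℕ} {x : EuclideanSpace ℝ (Fin n)}
    (hx : ‖x - bumpCenter i k‖ ≤ bumpRadius k) :
    3 / 4 * (1 / 2 : ℝ) ^ k ≤ ‖x‖ ∧ ‖x‖ ≤ 5 / 4 * (1 / 2 : ℝ) ^ k := by
  have h1 := bumpRadius_le k
  have h2 := norm_bumpCenter i k
  have h3 := norm_sub_norm_le x (bumpCenter i k)
  have h4 := norm_sub_norm_le (bumpCenter i k) x
  rw [norm_sub_rev] at h4
  constructor <;> linarith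

/-- The balls lie in disjoint spherical shells: for `k < l` the outer radius `5/4 · 2⁻ˡ` is at most
`5/8 · 2⁻ᵏ`, which is below the inner radius `3/4 · 2⁻ᵏ`. -/
theorem eq_of_mem_ball {i : Fin n} {k l : ℕ} {x : EuclideanSpace ℝ (Fin n)}
    (hk : ‖x - bumpCenter i k‖ ≤ bumpRadius k) (hl : ‖x - bumpCenter i l‖ ≤ bumpRadius l) :
    k = l := by
  wlog hlt : k < l generalizing k l
  · rcases (not_lt.1 hlt).lt_or_eq with h | h
    · exact (this hl hk h).symm
    · exact h.symm
  have h1 := (norm_bounds_of_mem_ball hk).1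
  have h2 := (norm_bounds_of_mem_ball hl).2
  have h3 : (1 / 2 : ℝ) ^ l ≤ (1 / 2 : ℝ) ^ (k + 1) :=
    pow_le_pow_of_le_one (by norm_num) (by norm_num) hlt
  have h4 : 0 < (1 / 2 : ℝ) ^ k := by positivity
  rw [pow_succ] at h3
  linarith

section BumpSum

variable {i : Fin n} {w : ℕ → EuclideanSpace ℝ (Fin n) → ℝ}

theorem tsum_bump_eq (hw : ∀ k x, bumpRadius k ≤ ‖x‖ → w k x = 0) {x : EuclideanSpace ℝ (Fin n)}
    {j : ℕ} (hj : ∀ k ≠ j, bumpRadius k < ‖x - bumpCenter i k‖) :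
    ∑' k, w k (x - bumpCenter i k) = w j (x - bumpCenter i j) :=
  tsum_eq_single j fun k hk => hw k _ (hj k hk).le

/-- The balls of large index lie close to the origin and miss a neighbourhood of `x ≠ 0`. Only
finitely many others remain, and each of them except the `j`-th stays away from `x`, hence from
nearby points. -/
theorem tsum_bump_eventuallyEq (hw : ∀ k x, bumpRadius k ≤ ‖x‖ → w k x = 0)
    {x : EuclideanSpace ℝ (Fin n)} (hx : x ≠ 0) {j : ℕ}
    (hj : ∀ k ≠ j, bumpRadius k < ‖x - bumpCenter i k‖) :
    (fun y => ∑' k, w k (y - bumpCenter i k)) =ᶠ[𝓝 x] fun y => w j (y - bumpCenter i j) := by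
  have hx0 := norm_pos_iff.2 hx
  obtain ⟨K, hK⟩ := exists_pow_lt_of_lt_one (by positivity : 0 < ‖x‖ / 4)
    (by norm_num : (1 / 2 : ℝ) < 1)
  have h1 : ∀ᶠ y in 𝓝 x, ‖x‖ / 2 < ‖y‖ :=
    continuous_norm.continuousAt.eventually (lt_mem_nhds (by linarith))
  have h2 : ∀ᶠ y in 𝓝 x, ∀ k ∈ Finset.range K, k ≠ j → bumpRadius k < ‖y - bumpCenter i k‖ := by
    rw [Filter.eventually_all_finset]
    intro k _
    by_cases hk : k = j
    · simp [hk]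
    · have : ContinuousAt (fun y => ‖y - bumpCenter i k‖) x := by fun_prop
      filter_upwards [this.eventually (lt_mem_nhds (hj k hk))] with y hy _ using hy
  filter_upwards [h1, h2] with y hy1 hy2
  refine tsum_bump_eq hw fun k hk => ?_
  by_cases hkK : k < K
  · exact hy2 k (Finset.mem_range.2 hkK) hk
  · by_contra hlt
    have h3 := (norm_bounds_of_mem_ball (not_lt.1 hlt)).2
    have h4 : (1 / 2 : ℝ) ^ k ≤ (1 / 2 : ℝ) ^ K :=
      pow_le_pow_of_le_one (by norm_num) (by norm_num) (not_lt.1 hkK)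
    linarith

theorem exists_forall_ne_lt_norm_sub (i : Fin n) (x : EuclideanSpace ℝ (Fin n)) :
    ∃ j : ℕ, ∀ k ≠ j, bumpRadius k < ‖x - bumpCenter i k‖ := by
  by_cases h : ∃ j, ‖x - bumpCenter i j‖ ≤ bumpRadius j
  · obtain ⟨j, hj⟩ := h
    exact ⟨j, fun k hk => not_le.1 fun hk' => hk (eq_of_mem_ball hk' hj)⟩
  · push Not at h
    -- Outside all balls every index serves; the sum then reduces to a bump that vanishes at `x`.
    exact ⟨0, fun k _ => h k⟩

end BumpSum

theorem laplacian_comp_sub_const (f : EuclideanSpace ℝ (Fin n) → ℝ)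
    (c x : EuclideanSpace ℝ (Fin n)) : (Δ fun y => f (y - c)) x = Δ f (x - c) := by
  simp only [laplacian_eq_sum_fderiv]
  rw [funext fun y => fderiv_comp_sub (𝕜 := ℝ) (f := f) (x := y) c]
  rw [fderiv_comp_sub]

/-- A function of class `C^2` off the origin, with bounded second derivative that does not tend to
zero at the origin, and with a Laplacian that tends to zero there. -/
theorem exists_oscillating_bump_sum (hn : 2 ≤ n) : ∃ (u : EuclideanSpace ℝ (Fin n) → ℝ) (C : ℝ),
    HasCompactSupport u ∧
    (∀ x, |u x| ≤ C * ‖x‖ ^ 2) ∧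
    (∀ x ≠ 0, ContDiffAt ℝ 2 u x ∧ ‖fderiv ℝ u x‖ ≤ C * ‖x‖ ^ 2 ∧
      ‖fderiv ℝ (fderiv ℝ u) x‖ ≤ C ∧ |Δ u x| ≤ C * ‖x‖) ∧
    ∃ c : ℕ → EuclideanSpace ℝ (Fin n), Filter.Tendsto c Filter.atTop (𝓝 0) ∧
      ∀ k, 1 ≤ ‖fderiv ℝ (fderiv ℝ u) (c k)‖ := by
  let i : Fin n := ⟨0, by omega⟩
  let j : Fin n := ⟨1, by omega⟩
  have hij : i ≠ j := by simp [i, j]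
  obtain ⟨C, hC⟩ := exists_saddle_bump hij
  -- Taking `ε = 2⁻ᵏ` makes the Laplacian of the `k`-th bump comparable to the distance of its
  -- support from the origin.
  choose w hw2 hw0 hwij hwb using fun k : ℕ =>
    hC ((1 / 2 : ℝ) ^ k) (by positivity) (half_pow_le_one k) (bumpRadius k) (bumpRadius_pos k)
  have hC0 : 0 ≤ C := (norm_nonneg (fderiv ℝ (fderiv ℝ (w 0)) 0)).trans (hwb 0 0).2.2.1
  set u : EuclideanSpace ℝ (Fin n) → ℝ := fun x => ∑' k, w k (x - bumpCenter i k) with hu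
  have hD (k : ℕ) : fderiv ℝ (fun y => w k (y - bumpCenter i k)) =
      fun x => fderiv ℝ (w k) (x - bumpCenter i k) :=
    funext fun y => fderiv_comp_sub (𝕜 := ℝ) (f := w k) (x := y) _
  have hD2 (k : ℕ) (x) : fderiv ℝ (fderiv ℝ (fun y => w k (y - bumpCenter i k))) x =
      fderiv ℝ (fderiv ℝ (w k)) (x - bumpCenter i k) := by
    rw [hD, fderiv_comp_sub]
  refine ⟨u, 2 * C, ?_, fun x => ?_, fun x hx => ?_, bumpCenter i, ?_, fun k => ?_⟩
  · refine HasCompactSupport.intro (isCompact_closedBall 0 (5 / 4)) fun x hx => ?_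
    rw [mem_closedBall_zero_iff, not_le] at hx
    refine (tsum_congr fun k => hw0 k _ (not_lt.1 fun hlt => ?_)).trans tsum_zero
    linarith [(norm_bounds_of_mem_ball hlt.le).2, half_pow_le_one k]
  · obtain ⟨k, hk⟩ := exists_forall_ne_lt_norm_sub i x
    rw [hu]
    simp only
    rw [tsum_bump_eq hw0 hk]
    by_cases hx : ‖x - bumpCenter i k‖ ≤ bumpRadius k
    · refine ((hwb k _).1).trans ?_
      have h1 := (norm_bounds_of_mem_ball hx).1
      have h2 := hx.trans (bumpRadius_le k)
      have h3 : 0 ≤ (1 / 2 : ℝ) ^ k := by positivity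
      calc C * ‖x - bumpCenter i k‖ ^ 2 ≤ C * ‖x‖ ^ 2 := by gcongr; linarith
        _ ≤ _ := by nlinarith [mul_nonneg hC0 (sq_nonneg ‖x‖)]
    · rw [hw0 k _ (not_le.1 hx).le, abs_zero]
      positivity
  · obtain ⟨k, hk⟩ := exists_forall_ne_lt_norm_sub i x
    have he := tsum_bump_eventuallyEq hw0 hx hk
    have heD := he.fderiv (𝕜 := ℝ)
    refine ⟨?_, ?_⟩
    · refine ContDiffAt.congr_of_eventuallyEq ?_ he
      exact ((hw2 k).comp (contDiff_id.sub contDiff_const)).contDiffAt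
    rw [heD.eq_of_nhds, heD.fderiv_eq,
      (InnerProductSpace.laplacian_congr_nhds he).eq_of_nhds]
    by_cases hxk : ‖x - bumpCenter i k‖ ≤ bumpRadius k
    · rw [hD2, hD, laplacian_comp_sub_const]
      obtain ⟨-, b1, b2, b3⟩ := hwb k (x - bumpCenter i k)
      have h1 := (norm_bounds_of_mem_ball hxk).1
      have h3 : 0 ≤ (1 / 2 : ℝ) ^ k := by positivity
      -- Here the quadratic radius matters: `4⁻ᵏ/4` is dominated by `‖x‖²`, so that the gradient of
      -- `u` is of second order at the origin.
      have h2 : ‖x - bumpCenter i k‖ ≤ 2 * ‖x‖ ^ 2 := by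
        refine hxk.trans ?_
        rw [bumpRadius]
        nlinarith
      refine ⟨b1.trans ?_, b2.trans (by linarith), b3.trans ?_⟩
      · calc _ ≤ C * (2 * ‖x‖ ^ 2) := by gcongr
          _ = _ := by ring
      · calc _ ≤ C * (2 * ‖x‖) := by gcongr; linarith
          _ = _ := by ring
    · have h0 : (fun y => w k (y - bumpCenter i k)) =ᶠ[𝓝 x] fun _ => 0 := by
        have : ContinuousAt (fun y => ‖y - bumpCenter i k‖) x := by fun_prop
        filter_upwards [this.eventually (lt_mem_nhds (not_le.1 hxk))] with y hy
          using hw0 k _ hy.le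
      rw [h0.fderiv.eq_of_nhds, h0.fderiv.fderiv_eq,
        (InnerProductSpace.laplacian_congr_nhds h0).eq_of_nhds, laplacian_eq_sum_fderiv]
      have hz : (fderiv ℝ fun _ : EuclideanSpace ℝ (Fin n) => (0 : ℝ)) = fun _ => 0 := by
        funext y; simp
      rw [hz, fderiv_fun_const]
      simp only [Pi.zero_apply, zero_apply, norm_zero, Finset.sum_const_zero, abs_zero]
      have hC2 : 0 ≤ 2 * C := by positivity
      exact ⟨by positivity, ContinuousLinearMap.opNorm_zero.trans_le hC2, by positivity⟩
  · rw [tendsto_zero_iff_norm_tendsto_zero]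
    simp only [norm_bumpCenter]
    exact tendsto_pow_atTop_nhds_zero_of_lt_one (by norm_num) (by norm_num)
  · have hmem : ‖bumpCenter i k - bumpCenter i k‖ ≤ bumpRadius k := by
      simpa using (bumpRadius_pos k).le
    have hne : bumpCenter i k ≠ 0 := norm_pos_iff.1 (by rw [norm_bumpCenter]; positivity)
    have he := tsum_bump_eventuallyEq hw0 hne
      fun l hl => not_le.1 fun hl' => hl (eq_of_mem_ball hl' hmem)
    -- At its centre, the `(i, j)` entry of the Hessian of the `k`-th bump is 1, tested on unit
    -- vectors.
    rw [he.fderiv.fderiv_eq, hD2, sub_self, ← hwij k]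
    refine (Real.le_norm_self _).trans ?_
    simpa using (fderiv ℝ (fderiv ℝ (w k)) 0).le_opNorm₂ (EuclideanSpace.single i 1)
      (EuclideanSpace.single j 1)

/-! ### Behaviour at the origin -/

/-- Serves twice, for `u` and for `Du`, and so provides both derivatives at the one point where `u`
is not known to be `C²`. -/
theorem hasFDerivAt_zero_of_norm_le_sq {E F : Type*} [NormedAddCommGroup E] [NormedSpace ℝ E]
    [NormedAddCommGroup F] [NormedSpace ℝ F] {f : E → F} {C : ℝ}
    (hf : ∀ x, ‖f x‖ ≤ C * ‖x‖ ^ 2) : HasFDerivAt f (0 : E →L[ℝ] F) 0 := by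
  have h0 : f 0 = 0 := by simpa using hf 0
  rw [hasFDerivAt_iff_isLittleO_nhds_zero]
  have h1 : f =O[𝓝 0] fun x => ‖x‖ ^ 2 :=
    Asymptotics.IsBigO.of_bound C (Filter.Eventually.of_forall fun x => by simpa using hf x)
  have h2 : (fun x : E => ‖x‖ ^ 2) =o[𝓝 0] fun x => x := by
    simpa using (Asymptotics.isLittleO_norm_pow_id (E' := E) (n := 2) (by norm_num))
  simpa [h0] using h1.trans_isLittleO h2

theorem continuousAt_zero_of_norm_le {E F : Type*} [NormedAddCommGroup E] [NormedAddCommGroup F]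
    {f : E → F} {g : E → ℝ} (hf : ∀ x, ‖f x‖ ≤ g x) (hg : ContinuousAt g 0) (hg0 : g 0 = 0) :
    ContinuousAt f 0 := by
  have h0 : f 0 = 0 := by simpa [hg0] using hf 0
  rw [ContinuousAt, h0]
  refine squeeze_zero_norm hf ?_
  simpa [ContinuousAt, hg0] using hg

end Graph

/-! ### The main theorem -/

theorem mainTheorem4 (n : ℕ) (hn : 2 ≤ n) :
    ∃ u : EuclideanSpace ℝ (Fin n) → ℝ,
      HasCompactSupport u ∧
      TwiceDifferentiableOn u Set.univ ∧
      Continuous (Δ u) ∧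
      (∃ C : ℝ, ∀ x, ‖fderiv ℝ (fderiv ℝ u) x‖ ≤ C) ∧
      ¬ ContDiff ℝ 2 u ∧
      IsTwiceDifferentiableHypersurface (graphOf u) ∧
      ¬ IsC2Hypersurface (graphOf u) ∧
      ∃ ν : EuclideanSpace ℝ (Fin (n + 1)) → EuclideanSpace ℝ (Fin (n + 1)),
        IsUnitNormalField (graphOf u) ν ∧
        DifferentiableOn ℝ ν (graphOf u) ∧
        ContinuousOn (meanCurvature (graphOf u) ν) (graphOf u) ∧
        ∃ C : ℝ, ∀ p ∈ graphOf u, ∀ v w : tangentSpaceOf (graphOf u) p,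
          |secondFundamentalForm (graphOf u) ν p v w| ≤ C * ‖v‖ * ‖w‖ := by
  obtain ⟨u, C, hsupp, hu0, hux, c, hc, hck⟩ := exists_oscillating_bump_sum hn
  have hd0 : HasFDerivAt u 0 0 := hasFDerivAt_zero_of_norm_le_sq hu0
  have hdx (x) (hx : x ≠ 0) : ContDiffAt ℝ 1 (fderiv ℝ u) x :=
    (hux x hx).1.fderiv_right (by norm_num)
  have hd2x (x) (hx : x ≠ 0) : ContinuousAt (fderiv ℝ (fderiv ℝ u)) x :=
    ((hdx x hx).fderiv_right (m := 0) (by norm_num)).continuousAt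
  have hu : Differentiable ℝ u := fun x => by
    by_cases hx : x = 0
    · rw [hx]; exact hd0.differentiableAt
    · exact (hux x hx).1.differentiableAt (by norm_num)
  have hDu (x) : ‖fderiv ℝ u x‖ ≤ C * ‖x‖ ^ 2 := by
    by_cases hx : x = 0
    · simp [hx, hd0.fderiv]
    · exact (hux x hx).2.1
  have hd20 : HasFDerivAt (fderiv ℝ u) 0 0 := hasFDerivAt_zero_of_norm_le_sq hDu
  have hu' : Differentiable ℝ (fderiv ℝ u) := fun x => by
    by_cases hx : x = 0
    · rw [hx]; exact hd20.differentiableAt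
    · exact (hdx x hx).differentiableAt (by norm_num)
  obtain ⟨x₁, hx₁⟩ : ∃ x : EuclideanSpace ℝ (Fin n), x ≠ 0 :=
    ⟨EuclideanSpace.single ⟨0, by omega⟩ 1, by simp⟩
  have hC0 : 0 ≤ C := (norm_nonneg (fderiv ℝ (fderiv ℝ u) x₁)).trans (hux x₁ hx₁).2.2.1
  have hD2 (x) : ‖fderiv ℝ (fderiv ℝ u) x‖ ≤ C := by
    by_cases hx : x = 0
    · rw [hx, hd20.fderiv]
      exact ContinuousLinearMap.opNorm_zero.trans_le hC0
    · exact (hux x hx).2.2.1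
  have hLap : Continuous (Δ u) := by
    refine continuous_iff_continuousAt.2 fun x => ?_
    by_cases hx : x = 0
    · subst hx
      refine continuousAt_zero_of_norm_le (g := fun x => C * ‖x‖) (fun x => ?_)
        (by fun_prop) (by simp)
      by_cases hx : x = 0
      · simp [hx, laplacian_eq_sum_fderiv, hd20.fderiv]
      · exact (hux x hx).2.2.2
    · rw [funext (laplacian_eq_sum_fderiv u)]
      have := hd2x x hx
      fun_prop
  -- Continuity would force the norms at the centres `c k` to tend to `‖D²u(0)‖ = 0`, although they
  -- are at least 1.
  have hnot : ¬ Continuous (fderiv ℝ (fderiv ℝ u)) := fun h => by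
    have h1 := Filter.Tendsto.norm
      (E := EuclideanSpace ℝ (Fin n) →L[ℝ] EuclideanSpace ℝ (Fin n) →L[ℝ] ℝ)
      ((h.tendsto 0).comp hc)
    rw [hd20.fderiv, ContinuousLinearMap.opNorm_zero] at h1
    exact absurd (ge_of_tendsto' h1 hck) (by norm_num)
  -- At the origin `D²u` is discontinuous but bounded, and it is applied to two copies of `Du`,
  -- which tends to 0.
  have hquad : Continuous fun x => fderiv ℝ (fderiv ℝ u) x (rieszVec n (fderiv ℝ u x))
      (rieszVec n (fderiv ℝ u x)) := by
    have hR : Continuous fun x => rieszVec n (fderiv ℝ u x) :=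
      (rieszVec n).continuous.comp hu'.continuous
    refine continuous_iff_continuousAt.2 fun x => ?_
    by_cases hx : x = 0
    · subst hx
      refine continuousAt_zero_of_norm_le
        (g := fun x => C * ‖rieszVec n (fderiv ℝ u x)‖ * ‖rieszVec n (fderiv ℝ u x)‖)
        (fun x => ?_) (by fun_prop) (by simp [hd0.fderiv])
      refine (ContinuousLinearMap.le_opNorm₂ _ _ _).trans ?_
      gcongr
      exact hD2 x
    · have := hd2x x hx
      fun_prop
  have hW : Continuous fun x => areaFactor n (fderiv ℝ u x) := by
    unfold areaFactor
    have := hu'.continuous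
    fun_prop
  refine ⟨u, hsupp, ⟨hu.differentiableOn, hu'.differentiableOn⟩, hLap, ⟨C, hD2⟩, fun h => ?_,
    isTwiceDifferentiableHypersurface_graphOf hu hu',
    fun h => hnot (h.continuous_fderiv_fderiv hu hu'), graphNormal u,
    isUnitNormalField_graphNormal hu hu',
    fun p _ => (hasFDerivAt_graphNormal (hu' _)).differentiableAt.differentiableWithinAt, ?_,
    ⟨C, fun p hp => abs_secondFundamentalForm_graphOf_le hp (hu _) (hu' _) (hD2 _)⟩⟩
  · exact hnot ((h.fderiv_right (m := 1) (by norm_num)).continuous_fderiv (by norm_num))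
  · refine ContinuousOn.congr (Continuous.continuousOn ?_)
      fun p hp => meanCurvature_graphOf hp (hu _) (hu' _)
    refine Continuous.comp (g := fun x => (areaFactor n (fderiv ℝ u x))⁻¹ * Δ u x -
      (areaFactor n (fderiv ℝ u x) ^ 3)⁻¹ * fderiv ℝ (fderiv ℝ u) x (rieszVec n (fderiv ℝ u x))
        (rieszVec n (fderiv ℝ u x))) ?_ (dropLast n).continuous
    exact ((hW.inv₀ fun x => (areaFactor_pos _).ne').mul hLap).sub
      (((hW.pow 3).inv₀ fun x => (pow_pos (areaFactor_pos _) 3).ne').mul hquad)
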